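/- Let $\alpha>1$, $A=1/\zeta(\alpha)$, and let requests $R(0),R(1),\dots$ be i.i.d. on the objects $r=1,2,3,\dots$ with Zipf popularity $\mathbb P(R=r)=q_r=A/r^{\alpha}$. Consider a full cache holding $C$ distinct objects. If the requested object is in the cache (hit), the state is unchanged. If it is not (miss), it is inserted and one object of the cache is evicted: under RND, an object chosen uniformly at random among the $C$ cached ones; under FIFO, the object that was inserted earliest. (The state is the set of cached objects for RND, and the list of cached objects in order of insertion for FIFO; a cache of size $0$ stays empty.) For each of the two policies and each $C\ge 0$ the resulting Markov chain has exactly one stationary distribution; let $M(C)=\mathbb P(R\notin \mathbf S)$ be the stationary miss probability, where $\mathbf S$ has the stationary distribution and $R$ is a request independent of $\mathbf S$. Put $$\rho_\alpha=\left(\frac{\pi/\alpha}{\sin(\pi/\alpha)}\right)^{\alpha}.$$ Then, for RND and for FIFO, as $C\to\infty$, $$M(C)\sim \rho_\alpha\, C\, q_C=\frac{A\rho_\alpha}{C^{\alpha-1}}.$$ Moreover $\lim_{\alpha\to+\infty}\rho_\alpha=1$ and $\rho_\alpha\sim \dfrac{1}{\alpha-1}$ as $\alpha\downarrow 1$. 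-/

import Mathlib

open Filter Topology Asymptotics
open scoped ENNReal

namespace CacheModel

noncomputable section

/-- The normalization constant `A = 1 / ζ(α)` of the Zipf distribution. -/
def zipfConst (α : ℝ) : ℝ := 1 / (riemannZeta (α : ℂ)).re

/-- The Zipf weight `A / r ^ α` of the object of rank `r`. -/
def zipfWeight (α : ℝ) (r : ℕ) : ℝ := zipfConst α / (r : ℝ) ^ α

theorem hasSum_zeta {α : ℝ} (hα : 1 < α) :
    HasSum (fun r : ℕ+ => 1 / ((r : ℕ) : ℝ) ^ α) (riemannZeta (α : ℂ)).re := by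
  have hs : Summable (fun n : ℕ => 1 / (n : ℝ) ^ α) := Real.summable_one_div_nat_rpow.2 hα
  have hz : riemannZeta (α : ℂ) = ((∑' n : ℕ, 1 / (n : ℝ) ^ α : ℝ) : ℂ) := by
    rw [zeta_eq_tsum_one_div_nat_cpow (by simpa using hα), Complex.ofReal_tsum]
    refine tsum_congr fun n => ?_
    rw [Complex.ofReal_div, Complex.ofReal_one, Complex.ofReal_cpow n.cast_nonneg,
      Complex.ofReal_natCast]
  rw [hz, Complex.ofReal_re]
  have h0 : ∀ x : ℕ, x ∉ Set.range ((↑) : ℕ+ → ℕ) → (fun n : ℕ => 1 / (n : ℝ) ^ α) x = 0 := by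
    intro x hx
    have hx0 : x = 0 := by
      by_contra h
      exact hx ⟨⟨x, Nat.pos_of_ne_zero h⟩, rfl⟩
    subst hx0
    simp [Real.zero_rpow (by linarith : α ≠ 0)]
  exact (Function.Injective.hasSum_iff PNat.coe_injective h0).2 hs.hasSum

theorem zeta_re_pos {α : ℝ} (hα : 1 < α) : 0 < (riemannZeta (α : ℂ)).re := by
  have h := hasSum_zeta hα
  have h1 := le_hasSum h (1 : ℕ+) fun r _ => by positivity
  simp at h1
  linarith

theorem zipfConst_pos {α : ℝ} (hα : 1 < α) : 0 < zipfConst α :=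
  one_div_pos.2 (zeta_re_pos hα)

/-- The Zipf popularity distribution on the object ranks `1, 2, 3, …`. -/
def zipf (α : ℝ) (hα : 1 < α) : PMF ℕ+ :=
  ⟨fun r => ENNReal.ofReal (zipfWeight α r), by
    have h : HasSum (fun r : ℕ+ => zipfWeight α r) 1 := by
      have h := (hasSum_zeta hα).mul_left (zipfConst α)
      rw [zipfConst, one_div_mul_cancel (zeta_re_pos hα).ne'] at h
      refine h.congr_fun ?_
      intro r
      simp [zipfWeight, zipfConst, div_eq_mul_inv]
    have hn : ∀ r : ℕ+, 0 ≤ zipfWeight α r := fun r =>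
      div_nonneg (zipfConst_pos hα).le (by positivity)
    have := ENNReal.hasSum_coe.2 (h.toNNReal hn)
    simpa [ENNReal.ofReal] using this⟩

/-- The prefactor `ρ_α = ((π/α) / sin (π/α)) ^ α`. -/
def rho (α : ℝ) : ℝ := ((Real.pi / α) / Real.sin (Real.pi / α)) ^ α

/-- States of a full RND cache of size `C`: the sets of `C` distinct objects. -/
abbrev RndState (C : ℕ) : Type := {s : Finset ℕ+ // s.card = C}

/-- The configuration in which the object `j` of the cache is replaced by `r`. -/
def RndState.replace {C : ℕ} (s : RndState C) (r : ℕ+) (hr : r ∉ s.1) (j : {j : ℕ+ // j ∈ s.1}) :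
    RndState C :=
  ⟨insert r (s.1.erase j.1), by
    rw [Finset.card_insert_of_notMem fun h => hr (Finset.mem_of_mem_erase h),
      Finset.card_erase_add_one j.2, s.2]⟩

/-- One step of the RND cache when requests have law `q`: an object `r` is drawn from `q`; on a hit
the state is unchanged; on a miss, `r` replaces an object drawn uniformly among those in the
cache (a cache of size `0` stays empty). -/
def rndStep (q : PMF ℕ+) {C : ℕ} (s : RndState C) : PMF (RndState C) :=
  q.bind fun r =>
    if h : r ∉ s.1 ∧ s.1.Nonempty then
      (PMF.uniformOfFinset s.1.attach (Finset.attach_nonempty_iff.2 h.2)).map (s.replace r h.1)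
    else PMF.pure s

/-- States of a full FIFO cache of size `C`: `C` distinct objects, listed from the most recently
inserted to the least recently inserted. -/
abbrev FifoState (C : ℕ) : Type := {l : List ℕ+ // l.Nodup ∧ l.length = C}

/-- Insert `r` in front of the queue and evict the oldest object (the last one). -/
def FifoState.push {C : ℕ} (l : FifoState C) (r : ℕ+) (hr : r ∉ l.1) : FifoState C :=
  ⟨(r :: l.1).dropLast,
    (List.nodup_cons.2 ⟨hr, l.2.1⟩).sublist (List.dropLast_sublist _), by
      simp [l.2.2]⟩

/-- One step of the FIFO cache when requests have law `q`: an object `r` is drawn from `q`; on a hit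
the state is unchanged; on a miss, `r` is inserted and the object that was inserted first is
evicted. -/
def fifoStep (q : PMF ℕ+) {C : ℕ} (l : FifoState C) : PMF (FifoState C) :=
  q.bind fun r => if h : r ∉ l.1 then PMF.pure (l.push r h) else PMF.pure l

/-- `μ` is a stationary distribution of the Markov chain with transition law `step`. -/
def IsStationary {S : Type} (step : S → PMF S) (μ : PMF S) : Prop := μ.bind step = μ

/-- The probability that a request of law `q` is a miss, when the cache is in a state of law `μ`
independent of the request; `content s` is the set of objects present in the state `s`. -/
def missProb {S : Type} (q : PMF ℕ+) (content : S → Set ℕ+) (μ : PMF S) : ℝ :=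
  (∑' s : S, μ s * ∑' r : {r : ℕ+ // r ∉ content s}, q r.1).toReal

/-- Miss probability of a size `C` RND cache whose state has law `μ`. -/
def rndMissProb (q : PMF ℕ+) {C : ℕ} (μ : PMF (RndState C)) : ℝ :=
  missProb q (fun s => {r | r ∈ s.1}) μ

/-- Miss probability of a size `C` FIFO cache whose state has law `μ`. -/
def fifoMissProb (q : PMF ℕ+) {C : ℕ} (μ : PMF (FifoState C)) : ℝ :=
  missProb q (fun l => {r | r ∈ l.1}) μ

end

end CacheModel

/-! Write `e_k` for the elementary symmetric functions of the weights `q`. Giving each state the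
product of its weights balances RND with itself and FIFO with the FIFO chain read backwards, so both
stationary laws are explicit. A FIFO list is an ordering of a set, which only brings in a factor
`C!`; hence both caches miss with probability `(C + 1) e_{C+1} / e_C`.

Let `a_k = e_{k+1} / e_k`, and let `E_k` be `e_k` computed without object `r`. Then `(k + 1) e_{k+1}
= ∑ q_r E_k`, and log-concavity of the elementary symmetric functions gives `e_{k+1} / (a_k + q_r) ≤
E_k ≤ e_{k+1} / (a_{k+1} + q_r)`. Summing over `r`, `∑ q_r / (a_k + q_r) ≤ k + 1 ≤ ∑ q_r / (a_{k+1}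
+ q_r)`: up to a bounded error, `a_k` solves `∑ q_r / (a + q_r) = k` (`tsum_div_esymmRatio_add_le`,
`le_tsum_div_esymmRatio_add`).

For Zipf weights put `a = A / b ^ α`. The sum becomes `∑ 1 / (1 + (r / b) ^ α) = b θ + O(1)` with `θ
= (π/α) / sin (π/α)`. Thus `b θ = C + O(1)` for `a = a_C`, and `(C + 1) A / b ^ α` is equivalent to
`A θ ^ α C ^ (1 - α)`, where `θ ^ α = ρ_α`. -/

namespace CacheModel

/-! ### Elementary symmetric functions of infinitely many weights. -/

section Esymm

variable {ι : Type*}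

/-- The elementary symmetric function of degree `k` of a family of extended nonnegative numbers. -/
noncomputable def infEsymm (q : ι → ℝ≥0∞) (k : ℕ) : ℝ≥0∞ :=
  ∑' s : {s : Finset ι // s.card = k}, ∏ i ∈ s.1, q i

/-- The sum of the product weights of the lists of `k` distinct elements. -/
noncomputable def listEsymm (q : ι → ℝ≥0∞) (k : ℕ) : ℝ≥0∞ :=
  ∑' l : {l : List ι // l.Nodup ∧ l.length = k}, (l.1.map q).prod

theorem infEsymm_zero (q : ι → ℝ≥0∞) : infEsymm q 0 = 1 := by
  rw [infEsymm, tsum_eq_single (⟨∅, rfl⟩ : {s : Finset ι // s.card = 0})]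
  · simp
  · rintro ⟨s, hs⟩ h
    exact absurd (Subtype.ext (Finset.card_eq_zero.1 hs)) h

theorem listEsymm_zero (q : ι → ℝ≥0∞) : listEsymm q 0 = 1 := by
  rw [listEsymm, tsum_eq_single
    (⟨[], List.nodup_nil, rfl⟩ : {l : List ι // l.Nodup ∧ l.length = 0})]
  · simp
  · rintro ⟨s, hs, hs'⟩ h
    exact absurd (Subtype.ext (List.length_eq_zero_iff.1 hs')) h

theorem infEsymm_ne_zero [Infinite ι] {q : ι → ℝ≥0∞} (hq : ∀ i, q i ≠ 0) (k : ℕ) :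
    infEsymm q k ≠ 0 := by
  obtain ⟨s, hs⟩ := Infinite.exists_subset_card_eq ι k
  intro h
  have := ENNReal.tsum_eq_zero.1 h ⟨s, hs⟩
  exact Finset.prod_ne_zero_iff.2 (fun i _ => hq i) this

theorem tendsto_sum_powersetCard (q : ι → ℝ≥0∞) (k : ℕ) :
    Tendsto (fun T : Finset ι => ∑ s ∈ T.powersetCard k, ∏ i ∈ s, q i) atTop
      (𝓝 (infEsymm q k)) := by
  have h : infEsymm q k = ∑' s : Finset ι, if s.card = k then ∏ i ∈ s, q i else 0 := by
    refine (tsum_subtype {s : Finset ι | s.card = k} (fun s => ∏ i ∈ s, q i)).trans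
      (tsum_congr fun s => ?_)
    simp [Set.indicator_apply]
  rw [h]
  refine (ENNReal.summable.hasSum.comp tendsto_finset_powerset_atTop_atTop).congr fun T => ?_
  simp [Finset.powersetCard_eq_filter, Finset.sum_filter]

/-- Multiplying a generating series by `1 + x t` preserves log-concavity. The condition ranges over
all `j ≤ i`, not only `j + 1 = i`, because some `E k` may vanish and ratios could not be chained
across a zero. -/
theorem logConcave_of_succ_eq_add {E F : ℕ → ℝ≥0∞} {x : ℝ≥0∞} (h0 : F 0 = E 0)
    (hs : ∀ k, F (k + 1) = E (k + 1) + x * E k)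
    (hE : ∀ i j, j ≤ i → E (i + 1) * E j ≤ E i * E (j + 1)) (i j : ℕ) (hij : j ≤ i) :
    F (i + 1) * F j ≤ F i * F (j + 1) := by
  obtain rfl | hlt := hij.eq_or_lt
  · rw [mul_comm]
  obtain ⟨i, rfl⟩ : ∃ i', i = i' + 1 := ⟨i - 1, by omega⟩
  -- `F 0` has no `x` term, so `j = 0` is expanded separately.
  obtain _ | j := j
  · rw [h0, hs, hs, hs]
    calc (E (i + 1 + 1) + x * E (i + 1)) * E 0 = E (i + 1 + 1) * E 0 + x * (E (i + 1) * E 0) := by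
          ring
      _ ≤ E (i + 1) * E (0 + 1) + x * (E (i + 1) * E 0) := by gcongr ?_ + _; exact hE _ _ (by omega)
      _ ≤ E (i + 1) * E (0 + 1) + x * (E (i + 1) * E 0) +
            x * E i * (E (0 + 1) + x * E 0) := le_self_add
      _ = _ := by ring
  · rw [hs, hs, hs, hs]
    have h1 : E (i + 1 + 1) * E (j + 1) ≤ E (i + 1) * E (j + 1 + 1) := hE _ _ (by omega)
    have h2 : E (i + 1 + 1) * E j ≤ E i * E (j + 1 + 1) :=
      (hE (i + 1) j (by omega)).trans (hE i (j + 1) (by omega))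
    have h3 : E (i + 1) * E j ≤ E i * E (j + 1) := hE _ _ (by omega)
    calc (E (i + 1 + 1) + x * E (i + 1)) * (E (j + 1) + x * E j)
        = E (i + 1 + 1) * E (j + 1) + x * (E (i + 1) * E (j + 1) + E (i + 1 + 1) * E j) +
            x * x * (E (i + 1) * E j) := by ring
      _ ≤ E (i + 1) * E (j + 1 + 1) + x * (E (i + 1) * E (j + 1) + E i * E (j + 1 + 1)) +
            x * x * (E i * E (j + 1)) := by gcongr
      _ = _ := by ring

variable [DecidableEq ι]

/-- Deleting object `r` is modelled by setting its weight to `0`: the index type stays the same, so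
every result on `infEsymm` applies to the deleted family. -/
theorem prod_update_zero_eq_ite (q : ι → ℝ≥0∞) (r : ι) (s : Finset ι) :
    ∏ i ∈ s, Function.update q r 0 i = if r ∉ s then ∏ i ∈ s, q i else 0 := by
  by_cases h : r ∈ s
  · rw [if_neg (not_not.2 h)]
    exact Finset.prod_eq_zero h (by simp)
  · rw [if_pos h]
    refine Finset.prod_congr rfl fun i hi => ?_
    rw [Function.update_of_ne]
    rintro rfl
    exact h hi

theorem list_prod_update_zero_eq_ite (q : ι → ℝ≥0∞) (r : ι) (l : List ι) :
    (l.map (Function.update q r 0)).prod = if r ∉ l then (l.map q).prod else 0 := by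
  by_cases h : r ∈ l
  · rw [if_neg (not_not.2 h)]
    exact List.prod_eq_zero (List.mem_map.2 ⟨r, h, by simp⟩)
  · rw [if_pos h]
    congr 1
    refine List.map_congr_left fun i hi => ?_
    rw [Function.update_of_ne]
    rintro rfl
    exact h hi

theorem tsum_ite_notMem_eq_infEsymm (q : ι → ℝ≥0∞) (r : ι) (k : ℕ) :
    (∑' s : {s : Finset ι // s.card = k}, if r ∉ s.1 then ∏ i ∈ s.1, q i else 0) =
      infEsymm (Function.update q r 0) k :=
  tsum_congr fun s => (prod_update_zero_eq_ite q r s.1).symm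

theorem tsum_ite_notMem_eq_listEsymm (q : ι → ℝ≥0∞) (r : ι) (k : ℕ) :
    (∑' l : {l : List ι // l.Nodup ∧ l.length = k}, if r ∉ l.1 then (l.1.map q).prod else 0) =
      listEsymm (Function.update q r 0) k :=
  tsum_congr fun l => (list_prod_update_zero_eq_ite q r l.1).symm

theorem tsum_ite_mem_eq_mul_infEsymm (q : ι → ℝ≥0∞) (r : ι) (k : ℕ) :
    (∑' s : {s : Finset ι // s.card = k + 1}, if r ∈ s.1 then ∏ i ∈ s.1, q i else 0) =
      q r * infEsymm (Function.update q r 0) k := by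
  rw [infEsymm, ← ENNReal.tsum_mul_left]
  have hns : ∀ s : {s : Finset ι // s.card = k},
      q r * ∏ i ∈ s.1, Function.update q r 0 i ≠ 0 → r ∉ s.1 := by
    intro s hs hr
    rw [prod_update_zero_eq_ite] at hs
    simp [hr] at hs
  refine tsum_eq_tsum_of_ne_zero_bij
    (fun s => ⟨insert r s.1.1, by rw [Finset.card_insert_of_notMem (hns s.1 s.2), s.1.2]⟩)
    ?_ ?_ ?_
  · rintro ⟨s, hs⟩ ⟨t, ht⟩ h
    simp only [Subtype.mk.injEq] at h
    have h1 := congrArg (fun u => Finset.erase u r) h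
    simp only [Finset.erase_insert (hns s hs), Finset.erase_insert (hns t ht)] at h1
    exact Subtype.ext (Subtype.ext h1)
  · rintro ⟨s, hs⟩ h
    simp only [Function.mem_support, ne_eq, ite_eq_right_iff, Classical.not_imp] at h
    refine ⟨⟨⟨s.erase r, by rw [Finset.card_erase_of_mem h.1, hs, Nat.add_sub_cancel]⟩, ?_⟩, ?_⟩
    · simp only [Function.mem_support, prod_update_zero_eq_ite, Finset.mem_erase, ne_eq,
        not_true_eq_false, false_and, not_false_eq_true, if_true, Finset.mul_prod_erase s q h.1]
      exact h.2
    · simp [Finset.insert_erase h.1]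
  · rintro ⟨s, hs⟩
    simp [prod_update_zero_eq_ite, hns s hs, Finset.prod_insert (hns s hs)]

theorem infEsymm_succ_eq_add (q : ι → ℝ≥0∞) (r : ι) (k : ℕ) :
    infEsymm q (k + 1) =
      infEsymm (Function.update q r 0) (k + 1) + q r * infEsymm (Function.update q r 0) k := by
  rw [← tsum_ite_notMem_eq_infEsymm, ← tsum_ite_mem_eq_mul_infEsymm, ← ENNReal.tsum_add, infEsymm]
  refine tsum_congr fun s => ?_
  by_cases h : r ∈ s.1 <;> simp [h]

/-- Double counting of the pairs `r ∈ s` with `s` of size `k + 1`. -/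
theorem succ_mul_infEsymm_succ (q : ι → ℝ≥0∞) (k : ℕ) :
    ((k + 1 : ℕ) : ℝ≥0∞) * infEsymm q (k + 1) =
      ∑' r, q r * infEsymm (Function.update q r 0) k := by
  simp_rw [← tsum_ite_mem_eq_mul_infEsymm]
  rw [ENNReal.tsum_comm, infEsymm, ← ENNReal.tsum_mul_left]
  refine tsum_congr fun s => ?_
  rw [tsum_eq_sum (s := s.1) (fun i hi => by simp [hi]),
    Finset.sum_congr rfl (fun i hi => if_pos hi), Finset.sum_const, s.2, nsmul_eq_mul]

theorem listEsymm_succ (q : ι → ℝ≥0∞) (k : ℕ) :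
    listEsymm q (k + 1) = ∑' r, q r * listEsymm (Function.update q r 0) k := by
  simp_rw [listEsymm, ← ENNReal.tsum_mul_left]
  rw [← ENNReal.tsum_prod (f := fun (r : ι) (l : {l : List ι // l.Nodup ∧ l.length = k}) =>
    q r * (l.1.map (Function.update q r 0)).prod)]
  have hns : ∀ p : ι × {l : List ι // l.Nodup ∧ l.length = k},
      q p.1 * (p.2.1.map (Function.update q p.1 0)).prod ≠ 0 → p.1 ∉ p.2.1 := by
    intro p hp hr
    rw [list_prod_update_zero_eq_ite] at hp
    simp [hr] at hp
  refine tsum_eq_tsum_of_ne_zero_bij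
    (fun p => ⟨p.1.1 :: p.1.2.1, List.nodup_cons.2 ⟨hns p.1 p.2, p.1.2.2.1⟩, by
      simp [p.1.2.2.2]⟩) ?_ ?_ ?_
  · rintro ⟨⟨r, l⟩, hs⟩ ⟨⟨r', l'⟩, ht⟩ h
    simp only [Subtype.mk.injEq, List.cons.injEq] at h
    obtain ⟨rfl, h⟩ := h
    have := Subtype.ext h
    subst this
    rfl
  · rintro ⟨l, hl, hk⟩ h
    obtain _ | ⟨r, l⟩ := l
    · simp at hk
    · rw [List.nodup_cons] at hl
      refine ⟨⟨⟨r, ⟨l, hl.2, by simpa using hk⟩⟩, ?_⟩, ?_⟩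
      · simpa [list_prod_update_zero_eq_ite, hl.1] using h
      · rfl
  · rintro ⟨⟨r, l⟩, hs⟩
    simp [list_prod_update_zero_eq_ite, hns _ hs]

theorem listEsymm_eq_factorial_mul (k : ℕ) (q : ι → ℝ≥0∞) :
    listEsymm q k = (k.factorial : ℝ≥0∞) * infEsymm q k := by
  induction k generalizing q with
  | zero => simp [infEsymm_zero, listEsymm_zero]
  | succ k ih =>
    simp_rw [listEsymm_succ, ih, Nat.factorial_succ, Nat.mul_comm (k + 1), Nat.cast_mul, mul_assoc,
      succ_mul_infEsymm_succ, ← ENNReal.tsum_mul_left]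
    exact tsum_congr fun r => by ring

theorem infEsymm_update_zero_le (q : ι → ℝ≥0∞) (r : ι) (k : ℕ) :
    infEsymm (Function.update q r 0) k ≤ infEsymm q k := by
  refine ENNReal.tsum_le_tsum fun s => ?_
  rw [prod_update_zero_eq_ite]
  split_ifs <;> simp

theorem infEsymm_ne_top {q : ι → ℝ≥0∞} (hq : ∑' i, q i ≠ ∞) (k : ℕ) : infEsymm q k ≠ ∞ := by
  induction k with
  | zero => simp [infEsymm_zero]
  | succ k ih =>
    have h : infEsymm q (k + 1) ≤ (∑' i, q i) * infEsymm q k := by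
      calc infEsymm q (k + 1) ≤ ((k + 1 : ℕ) : ℝ≥0∞) * infEsymm q (k + 1) :=
            le_mul_of_one_le_left' (by exact_mod_cast Nat.succ_pos k)
        _ ≤ _ := by
          rw [succ_mul_infEsymm_succ, ← ENNReal.tsum_mul_right]
          exact ENNReal.tsum_le_tsum fun r => by
            gcongr
            exact infEsymm_update_zero_le q r k
    exact ne_top_of_le_ne_top (ENNReal.mul_ne_top hq ih) h

theorem sum_powersetCard_logConcave (q : ι → ℝ≥0∞) (T : Finset ι) (i j : ℕ) (hij : j ≤ i) :
    (∑ s ∈ T.powersetCard (i + 1), ∏ i ∈ s, q i) * (∑ s ∈ T.powersetCard j, ∏ i ∈ s, q i) ≤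
      (∑ s ∈ T.powersetCard i, ∏ i ∈ s, q i) *
        (∑ s ∈ T.powersetCard (j + 1), ∏ i ∈ s, q i) := by
  induction T using Finset.induction_on generalizing i j with
  | empty =>
    rw [Finset.powersetCard_eq_empty.2 (by simp : (∅ : Finset ι).card < i + 1)]
    simp
  | insert a T ha ih =>
    refine logConcave_of_succ_eq_add
      (F := fun k => ∑ s ∈ (insert a T).powersetCard k, ∏ i ∈ s, q i)
      (E := fun k => ∑ s ∈ T.powersetCard k, ∏ i ∈ s, q i) (x := q a) (by simp) (fun k => ?_)
      ih i j hij
    have hm : ∀ s ∈ T.powersetCard k, a ∉ s := fun s hs h =>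
      ha ((Finset.mem_powersetCard.1 hs).1 h)
    simp only [Finset.powersetCard_succ_insert ha]
    rw [Finset.sum_union, Finset.sum_image, Finset.mul_sum]
    · congr 1
      exact Finset.sum_congr rfl fun s hs => Finset.prod_insert (hm s hs)
    · intro s hs t ht h
      rw [← Finset.erase_insert (hm s hs), h, Finset.erase_insert (hm t ht)]
    · rw [Finset.disjoint_left]
      intro s hs hs'
      obtain ⟨t, -, rfl⟩ := Finset.mem_image.1 hs'
      exact ha ((Finset.mem_powersetCard.1 hs).1 (Finset.mem_insert_self a t))

/-- Newton's inequality, in the weak form of log-concavity. -/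
theorem infEsymm_logConcave {q : ι → ℝ≥0∞} (hq : ∑' i, q i ≠ ∞) {i j : ℕ} (hij : j ≤ i) :
    infEsymm q (i + 1) * infEsymm q j ≤ infEsymm q i * infEsymm q (j + 1) := by
  have ht : ∀ k l, Tendsto (fun T : Finset ι => (∑ s ∈ T.powersetCard k, ∏ i ∈ s, q i) *
      ∑ s ∈ T.powersetCard l, ∏ i ∈ s, q i) atTop (𝓝 (infEsymm q k * infEsymm q l)) :=
    fun k l => ENNReal.Tendsto.mul (tendsto_sum_powersetCard q k)
      (Or.inr (infEsymm_ne_top hq l)) (tendsto_sum_powersetCard q l)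
      (Or.inr (infEsymm_ne_top hq k))
  exact le_of_tendsto_of_tendsto' (ht _ _) (ht _ _) fun T =>
    sum_powersetCard_logConcave q T i j hij

theorem tsum_update_zero_ne_top {q : ι → ℝ≥0∞} (hq : ∑' i, q i ≠ ∞) (r : ι) :
    ∑' i, Function.update q r 0 i ≠ ∞ := by
  refine ne_top_of_le_ne_top hq (ENNReal.tsum_le_tsum fun i => ?_)
  by_cases h : i = r
  · subst h; simp
  · simp [h]

/-- Once everything is expanded in the deleted family `E`, the two sides differ exactly by `E (k +
2) * E k ≤ E (k + 1) ^ 2`. This is the upper bound on `E k`, cleared of denominators. -/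
theorem infEsymm_update_mul_add_le {q : ι → ℝ≥0∞} (hq : ∑' i, q i ≠ ∞) (r : ι) (k : ℕ) :
    infEsymm (Function.update q r 0) k * (infEsymm q (k + 2) + q r * infEsymm q (k + 1)) ≤
      infEsymm q (k + 1) * infEsymm q (k + 1) := by
  have h := infEsymm_logConcave (tsum_update_zero_ne_top hq r) (Nat.le_succ k)
  rw [infEsymm_succ_eq_add q r (k + 1), infEsymm_succ_eq_add q r k]
  generalize infEsymm (Function.update q r 0) = E at *
  calc E k * (E (k + 1 + 1) + q r * E (k + 1) + q r * (E (k + 1) + q r * E k))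
      = E (k + 1 + 1) * E k + (2 * q r * E k * E (k + 1) + q r * q r * E k * E k) := by ring
    _ ≤ E (k + 1) * E (k + 1) + (2 * q r * E k * E (k + 1) + q r * q r * E k * E k) := by gcongr
    _ = _ := by ring

/-- The matching lower bound on `E k`; for positive `k` it is the same log-concavity inequality,
multiplied by `q r`. -/
theorem le_infEsymm_update_mul_add {q : ι → ℝ≥0∞} (hq : ∑' i, q i ≠ ∞) (r : ι) (k : ℕ) :
    infEsymm q (k + 1) * infEsymm q k ≤
      infEsymm (Function.update q r 0) k * (infEsymm q (k + 1) + q r * infEsymm q k) := by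
  obtain _ | k := k
  · simp only [infEsymm_zero, one_mul, mul_one]
    exact le_self_add
  have h := infEsymm_logConcave (tsum_update_zero_ne_top hq r) (Nat.le_succ k)
  rw [infEsymm_succ_eq_add q r (k + 1), infEsymm_succ_eq_add q r k]
  generalize infEsymm (Function.update q r 0) = E at *
  calc (E (k + 1 + 1) + q r * E (k + 1)) * (E (k + 1) + q r * E k)
      = q r * (E (k + 1 + 1) * E k) +
        (E (k + 1 + 1) * E (k + 1) + q r * E (k + 1) * (E (k + 1) + q r * E k)) := by ring
    _ ≤ q r * (E (k + 1) * E (k + 1)) +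
        (E (k + 1 + 1) * E (k + 1) + q r * E (k + 1) * (E (k + 1) + q r * E k)) := by gcongr
    _ = _ := by ring

end Esymm

/-! ### Stationary laws of Markov chains on a general state space. -/

section Markov

variable {S : Type}

theorem eq_of_le_of_tsum_eq {f g : S → ℝ≥0∞} (hle : ∀ s, f s ≤ g s)
    (hg : ∑' s, g s ≠ ∞) (h : ∑' s, f s = ∑' s, g s) (s : S) : f s = g s := by
  by_contra hne
  exact (ENNReal.tsum_lt_tsum (h ▸ hg) hle (lt_of_le_of_ne (hle s) hne)).ne h

theorem tsum_tsum_mul_kernel (P : S → PMF S) (f : S → ℝ≥0∞) :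
    ∑' t, ∑' s, f s * P s t = ∑' s, f s := by
  rw [ENNReal.tsum_comm]
  simp_rw [ENNReal.tsum_mul_left, PMF.tsum_coe, mul_one]

theorem isStationary_iff {P : S → PMF S} {μ : PMF S} :
    IsStationary P μ ↔ ∀ t, ∑' s, μ s * P s t = μ t := by
  rw [IsStationary, PMF.ext_iff]
  simp_rw [PMF.bind_apply]

theorem ne_zero_of_reachable {P : S → PMF S} {f : S → ℝ≥0∞}
    (hf : ∀ t, ∑' s, f s * P s t = f t) {s t : S}
    (h : Relation.ReflTransGen (fun s t => P s t ≠ 0) s t) (hs : f s ≠ 0) : f t ≠ 0 := by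
  induction h with
  | refl => exact hs
  | tail _ hbc ih =>
    rename_i b c _
    intro h0
    rw [← hf c, ENNReal.tsum_eq_zero] at h0
    exact mul_ne_zero ih hbc (h0 b)

theorem tsum_sub_mul_kernel {P : S → PMF S} {f g : S → ℝ≥0∞} (hgf : ∀ s, g s ≤ f s)
    (hg : ∀ s, g s ≠ ∞) (hf : ∀ t, ∑' s, f s * P s t = f t)
    (hgP : ∀ t, ∑' s, g s * P s t = g t) (t : S) :
    ∑' s, (f s - g s) * P s t = f t - g t := by
  refine (ENNReal.sub_eq_of_eq_add (hg t) ?_).symm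
  conv_rhs => rw [← hgP t]
  rw [← ENNReal.tsum_add, ← hf t]
  refine tsum_congr fun s => ?_
  rw [← add_mul, tsub_add_cancel_of_le (hgf s)]

/-- A Markov chain in which any two states have a common descendant has at most one stationary
distribution. -/
theorem IsStationary.eq_of_common_reachable {P : S → PMF S}
    (hP : ∀ s t, ∃ u, Relation.ReflTransGen (fun s t => P s t ≠ 0) s u ∧
      Relation.ReflTransGen (fun s t => P s t ≠ 0) t u)
    {μ ν : PMF S} (hμ : IsStationary P μ) (hν : IsStationary P ν) : μ = ν := by
  rw [isStationary_iff] at hμ hν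
  have hfin : ∀ s, min (μ s) (ν s) ≠ ∞ := fun s =>
    ne_top_of_le_ne_top (μ.apply_ne_top s) (min_le_left _ _)
  have hsum : ∑' s, min (μ s) (ν s) ≠ ∞ :=
    ne_top_of_le_ne_top μ.tsum_coe_ne_top (ENNReal.tsum_le_tsum fun s => min_le_left _ _)
  -- The minimum of two invariant laws can only decrease under the kernel, which nevertheless
  -- preserves its finite total mass; so it is invariant too.
  have hmin : ∀ t, ∑' s, min (μ s) (ν s) * P s t = min (μ t) (ν t) := by
    refine eq_of_le_of_tsum_eq (fun t => le_min ?_ ?_) hsum (tsum_tsum_mul_kernel P _)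
    · rw [← hμ t]
      exact ENNReal.tsum_le_tsum fun s => by gcongr; exact min_le_left _ _
    · rw [← hν t]
      exact ENNReal.tsum_le_tsum fun s => by gcongr; exact min_le_right _ _
  have hμ' := tsum_sub_mul_kernel (fun s => min_le_left (μ s) (ν s)) hfin hμ hmin
  have hν' := tsum_sub_mul_kernel (fun s => min_le_right (μ s) (ν s)) hfin hν hmin
  by_contra hne
  have h1 : ∃ s, μ s - min (μ s) (ν s) ≠ 0 := by
    by_contra! h
    refine hne (PMF.ext (eq_of_le_of_tsum_eq (fun s => ?_) ν.tsum_coe_ne_top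
      (by rw [μ.tsum_coe, ν.tsum_coe])))
    exact (tsub_eq_zero_iff_le.1 (h s)).trans (min_le_right _ _)
  have h2 : ∃ s, ν s - min (μ s) (ν s) ≠ 0 := by
    by_contra! h
    refine hne (PMF.ext (eq_of_le_of_tsum_eq (fun s => ?_) μ.tsum_coe_ne_top
      (by rw [μ.tsum_coe, ν.tsum_coe]))).symm
    exact (tsub_eq_zero_iff_le.1 (h s)).trans (min_le_left _ _)
  -- The two excesses over the minimum are invariant, nonzero and have disjoint supports. Supports
  -- are closed under reachability, so a common descendant would lie in both.
  obtain ⟨s, hs⟩ := h1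
  obtain ⟨t, ht⟩ := h2
  obtain ⟨u, hsu, htu⟩ := hP s t
  have h3 := ne_zero_of_reachable (f := fun s => μ s - min (μ s) (ν s)) hμ' hsu hs
  have h4 := ne_zero_of_reachable (f := fun s => ν s - min (μ s) (ν s)) hν' htu ht
  rcases le_total (μ u) (ν u) with h | h
  · exact h3 (by simp [h])
  · exact h4 (by simp [h])

/-- A weight in balance with respect to a reversed kernel is stationary after normalization. -/
theorem isStationary_normalize_of_balance {P Q : S → PMF S} {w : S → ℝ≥0∞}
    (h0 : ∑' s, w s ≠ 0) (h1 : ∑' s, w s ≠ ∞) (h : ∀ s t, w s * P s t = w t * Q t s) :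
    IsStationary P (PMF.normalize w h0 h1) := by
  rw [isStationary_iff]
  intro t
  simp_rw [PMF.normalize_apply, mul_right_comm _ _ (P _ t), h]
  rw [ENNReal.tsum_mul_right, ENNReal.tsum_mul_left, PMF.tsum_coe, mul_one]

theorem missProb_normalize (q : PMF ℕ+) (content : S → Set ℕ+) {w : S → ℝ≥0∞}
    (h0 : ∑' s, w s ≠ 0) (h1 : ∑' s, w s ≠ ∞) :
    missProb q content (PMF.normalize w h0 h1) =
      ((∑' r, q r * ∑' s, (content s)ᶜ.indicator (fun _ => w s) r) / ∑' s, w s).toReal := by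
  rw [missProb]
  congr 1
  have h : ∀ s, ∑' r : {r : ℕ+ // r ∉ content s}, q r.1 = ∑' r, (content s)ᶜ.indicator q r :=
    fun s => tsum_subtype (content s)ᶜ q
  simp_rw [h, PMF.normalize_apply, div_eq_mul_inv, ← ENNReal.tsum_mul_left]
  rw [ENNReal.tsum_comm, ← ENNReal.tsum_mul_right]
  refine tsum_congr fun r => ?_
  rw [← ENNReal.tsum_mul_right]
  refine tsum_congr fun s => ?_
  by_cases hr : r ∈ content s
  · simp [hr]
  · simp only [Set.indicator_of_mem (show r ∈ (content s)ᶜ from hr)]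
    ring

end Markov

/-! ### Reachability in the RND and FIFO chains. -/

section Cache

variable {q : PMF ℕ+}

theorem rndStep_apply_ne_zero (hq : ∀ r, q r ≠ 0) {C : ℕ} (s : RndState C) (r : ℕ+)
    (hr : r ∉ s.1) (j : {j : ℕ+ // j ∈ s.1}) : rndStep q s (s.replace r hr j) ≠ 0 := by
  have hne : s.1.Nonempty := ⟨j.1, j.2⟩
  rw [← PMF.mem_support_iff, rndStep, PMF.mem_support_bind_iff]
  refine ⟨r, (PMF.mem_support_iff _ _).2 (hq r), ?_⟩
  rw [dif_pos ⟨hr, hne⟩, PMF.mem_support_map_iff]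
  exact ⟨j, by simp, rfl⟩

theorem rnd_reachable (hq : ∀ r, q r ≠ 0) {C : ℕ} (s t : RndState C) :
    Relation.ReflTransGen (fun s t => rndStep q s t ≠ 0) s t := by
  induction hn : (t.1 \ s.1).card generalizing s with
  | zero =>
    rw [Finset.card_eq_zero, Finset.sdiff_eq_empty_iff_subset] at hn
    rw [Subtype.ext (Finset.eq_of_subset_of_card_le hn (by rw [s.2, t.2]))]
  | succ n ih =>
    -- Equal cardinalities provide an unwanted object `j` to trade for a missing one `r`.
    obtain ⟨r, hr⟩ := Finset.card_pos.1 (by omega : 0 < (t.1 \ s.1).card)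
    have hcard : (s.1 \ t.1).card = (t.1 \ s.1).card :=
      Finset.card_sdiff_comm (by rw [s.2, t.2])
    obtain ⟨j, hj⟩ := Finset.card_pos.1 (by omega : 0 < (s.1 \ t.1).card)
    rw [Finset.mem_sdiff] at hr hj
    refine Relation.ReflTransGen.head (rndStep_apply_ne_zero hq s r hr.2 ⟨j, hj.1⟩) (ih _ ?_)
    have h : t.1 \ (s.replace r hr.2 ⟨j, hj.1⟩).1 = (t.1 \ s.1).erase r := by
      ext x
      simp only [RndState.replace, Finset.mem_sdiff, Finset.mem_insert, Finset.mem_erase]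
      constructor
      · rintro ⟨h1, h2⟩
        push Not at h2
        refine ⟨h2.1, h1, fun h3 => h2.2 ?_ h3⟩
        rintro rfl
        exact hj.2 h1
      · tauto
    rw [h, Finset.card_erase_of_mem (Finset.mem_sdiff.2 hr), hn, Nat.add_sub_cancel]

theorem fifoStep_apply_ne_zero (hq : ∀ r, q r ≠ 0) {C : ℕ} (l : FifoState C) (r : ℕ+)
    (hr : r ∉ l.1) : fifoStep q l (l.push r hr) ≠ 0 := by
  rw [← PMF.mem_support_iff, fifoStep, PMF.mem_support_bind_iff]
  refine ⟨r, (PMF.mem_support_iff _ _).2 (hq r), ?_⟩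
  rw [dif_pos hr]
  simp

theorem fifo_reachable (hq : ∀ r, q r ≠ 0) {C : ℕ} (l : FifoState C) (m : List ℕ+)
    (hm : (m ++ l.1).Nodup) (t : FifoState C) (ht : t.1 = (m ++ l.1).take C) :
    Relation.ReflTransGen (fun s t => fifoStep q s t ≠ 0) l t := by
  induction m generalizing t with
  | nil =>
    have : l = t := Subtype.ext (by
      rw [ht, List.nil_append]
      exact (List.take_of_length_le l.2.2.le).symm)
    rw [this]
  | cons r m ih =>
    rw [List.cons_append, List.nodup_cons] at hm
    let u : FifoState C := ⟨(m ++ l.1).take C, hm.2.sublist (List.take_sublist _ _), by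
      simp [l.2.2]⟩
    have hr : r ∉ u.1 := fun h => hm.1 (List.mem_of_mem_take h)
    have htu : t = u.push r hr := by
      refine Subtype.ext ?_
      rw [ht]
      have hu : u.1.length = C := u.2.2
      simp only [FifoState.push, List.dropLast_eq_take, List.length_cons, hu,
        Nat.add_sub_cancel, List.cons_append]
      cases C with
      | zero => simp
      | succ n => simp [u, List.take_take]
    rw [htu]
    exact (ih hm.2 u rfl).tail (fifoStep_apply_ne_zero hq u r hr)

/-- Requesting `C` objects absent from both queues, in the same order, flushes both caches into the
same state. -/
theorem fifo_common_reachable (hq : ∀ r, q r ≠ 0) {C : ℕ} (l l' : FifoState C) :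
    ∃ u, Relation.ReflTransGen (fun s t => fifoStep q s t ≠ 0) l u ∧
      Relation.ReflTransGen (fun s t => fifoStep q s t ≠ 0) l' u := by
  obtain ⟨s, hs, hcard⟩ :=
    (Set.Finite.infinite_compl (l.1.toFinset ∪ l'.1.toFinset).finite_toSet).exists_subset_card_eq C
  have hmem : ∀ x ∈ s.toList, x ∉ l.1 ∧ x ∉ l'.1 := fun x hx => by
    simpa using hs (Finset.mem_toList.1 hx)
  have hlen : s.toList.length = C := by rw [Finset.length_toList, hcard]
  have hnd : ∀ k : FifoState C, (∀ x ∈ s.toList, x ∉ k.1) → (s.toList ++ k.1).Nodup :=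
    fun k hk => List.nodup_append.2 ⟨s.nodup_toList, k.2.1, fun a ha b hb hab =>
      hk a ha (hab ▸ hb)⟩
  refine ⟨⟨s.toList, s.nodup_toList, hlen⟩,
    fifo_reachable hq l s.toList (hnd l fun x hx => (hmem x hx).1) _ ?_,
    fifo_reachable hq l' s.toList (hnd l' fun x hx => (hmem x hx).2) _ ?_⟩ <;>
  exact (List.take_left' hlen).symm

end Cache

/-! ### Balance equations and the exact miss probability. -/

section Cache

variable {q : PMF ℕ+}

theorem rndStep_apply_of_ne {C : ℕ} {s t : RndState C} (hst : s ≠ t) :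
    rndStep q s t = ∑' r, ∑' j, if r ∉ s.1 ∧ j ∈ s.1 ∧ insert r (s.1.erase j) = t.1 then
      q r * (C : ℝ≥0∞)⁻¹ else 0 := by
  rw [rndStep, PMF.bind_apply]
  refine tsum_congr fun r => ?_
  by_cases hr : r ∈ s.1
  · rw [dif_neg (fun h => h.1 hr), PMF.pure_apply_of_ne _ _ hst.symm]
    simp [hr]
  by_cases hne : s.1.Nonempty
  · rw [dif_pos ⟨hr, hne⟩, PMF.map_apply, ← ENNReal.tsum_mul_left]
    have h := tsum_subtype (s.1 : Set ℕ+)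
      (fun j => if insert r (s.1.erase j) = t.1 then q r * (C : ℝ≥0∞)⁻¹ else 0)
    refine (Eq.trans ?_ h).trans ?_
    · refine tsum_congr fun j => ?_
      simp only [PMF.uniformOfFinset_apply, Finset.mem_attach, if_true, Finset.card_attach, s.2,
        Subtype.ext_iff, RndState.replace, mul_ite, mul_zero]
      exact if_congr eq_comm rfl rfl
    · refine tsum_congr fun j => ?_
      by_cases hj : j ∈ s.1 <;> simp [hr, hj]
  · rw [dif_neg (fun h => hne h.2), PMF.pure_apply_of_ne _ _ hst.symm]
    rw [Finset.not_nonempty_iff_eq_empty] at hne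
    simp [hne]

theorem insert_erase_eq_symm {r j : ℕ+} {s t : Finset ℕ+}
    (h : r ∉ s ∧ j ∈ s ∧ insert r (s.erase j) = t) :
    j ∉ t ∧ r ∈ t ∧ insert j (t.erase r) = s := by
  obtain ⟨hr, hj, rfl⟩ := h
  have hjr : j ≠ r := fun h => hr (h ▸ hj)
  refine ⟨by simp [hjr], by simp, ?_⟩
  rw [Finset.erase_insert (fun h => hr (Finset.mem_of_mem_erase h)), Finset.insert_erase hj]

/-- Exchanging the inserted object `r` and the evicted object `j` matches the moves `s → t` with the
moves `t → s`. -/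
theorem rnd_balance {C : ℕ} (s t : RndState C) :
    (∏ i ∈ s.1, q i) * rndStep q s t = (∏ i ∈ t.1, q i) * rndStep q t s := by
  by_cases hst : s = t
  · rw [hst]
  rw [rndStep_apply_of_ne hst, rndStep_apply_of_ne (Ne.symm hst)]
  simp_rw [← ENNReal.tsum_mul_left]
  rw [ENNReal.tsum_comm]
  refine tsum_congr fun j => tsum_congr fun r => ?_
  by_cases h : r ∉ s.1 ∧ j ∈ s.1 ∧ insert r (s.1.erase j) = t.1
  · rw [if_pos h, if_pos (insert_erase_eq_symm h), ← h.2.2,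
      Finset.prod_insert (fun h' => h.1 (Finset.mem_of_mem_erase h')),
      ← Finset.mul_prod_erase s.1 q h.2.1]
    ring
  · rw [if_neg h, if_neg (fun h' => h (insert_erase_eq_symm h'))]
    simp

/-- The queue read backwards. -/
def FifoState.reverse {C : ℕ} (l : FifoState C) : FifoState C :=
  ⟨l.1.reverse, List.nodup_reverse.2 l.2.1, by simp [l.2.2]⟩

theorem FifoState.reverse_bijective (C : ℕ) :
    Function.Bijective (FifoState.reverse : FifoState C → FifoState C) :=
  Function.Involutive.bijective fun l => Subtype.ext (List.reverse_reverse l.1)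

theorem dropLast_eq_iff_exists {r : ℕ+} {l t : List ℕ+} :
    (r :: l).dropLast = t ↔ ∃ j, r :: l = t ++ [j] := by
  constructor
  · rintro rfl
    exact ⟨_, (List.dropLast_append_getLast (List.cons_ne_nil r l)).symm⟩
  · rintro ⟨j, h⟩
    rw [h, List.dropLast_concat]

/-- The evicted object `j` is summed over, although `l` and `r` determine it, so that the time
reversal can exchange `r` and `j`. -/
theorem fifoStep_apply {C : ℕ} (l t : FifoState C) :
    fifoStep q l t = (∑' r, ∑' j, if r ∉ l.1 ∧ r :: l.1 = t.1 ++ [j] then q r else 0) +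
      ∑' r, if r ∈ l.1 ∧ l = t then q r else 0 := by
  rw [fifoStep, PMF.bind_apply, ← ENNReal.tsum_add]
  refine tsum_congr fun r => ?_
  by_cases hr : r ∈ l.1
  · simp [hr, PMF.pure_apply, eq_comm (a := t)]
  · rw [dif_pos hr]
    simp only [hr, not_false_eq_true, true_and, false_and, if_false, add_zero, PMF.pure_apply,
      mul_ite, mul_one, mul_zero]
    have h : t = l.push r hr ↔ ∃ j, r :: l.1 = t.1 ++ [j] := by
      rw [← dropLast_eq_iff_exists, Subtype.ext_iff, eq_comm]
      rfl
    by_cases hj : ∃ j, r :: l.1 = t.1 ++ [j]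
    · rw [if_pos (h.2 hj)]
      obtain ⟨j, hj⟩ := hj
      rw [tsum_eq_single j, if_pos hj]
      intro j' hj'
      rw [if_neg]
      intro hj2
      rw [hj] at hj2
      simp at hj2
      exact hj' hj2.symm
    · rw [if_neg (fun h' => hj (h.1 h'))]
      push Not at hj
      simp [hj]

/-- Run backwards, a miss takes `r` off the front and restores `j` at the back: in the reversed
queues this is again a FIFO miss, requesting `j` and evicting `r`. -/
theorem fifo_balance {C : ℕ} (l t : FifoState C) :
    (l.1.map q).prod * fifoStep q l t =
      (t.1.map q).prod * fifoStep q t.reverse l.reverse := by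
  rw [fifoStep_apply, fifoStep_apply, mul_add, mul_add]
  congr 1
  · simp_rw [← ENNReal.tsum_mul_left]
    rw [ENNReal.tsum_comm]
    refine tsum_congr fun j => tsum_congr fun r => ?_
    have hrev : j :: t.reverse.1 = l.reverse.1 ++ [r] ↔ r :: l.1 = t.1 ++ [j] := by
      simp only [FifoState.reverse]
      rw [← List.reverse_concat', ← List.reverse_cons, List.reverse_inj, eq_comm]
    simp only [hrev]
    by_cases h : r :: l.1 = t.1 ++ [j]
    · have hn : r ∉ l.1 ↔ j ∉ t.reverse.1 := by
        have h1 : (r :: l.1).Nodup ↔ r ∉ l.1 := by simp [List.nodup_cons, l.2.1]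
        have h2 : (t.1 ++ [j]).Nodup ↔ j ∉ t.reverse.1 := by
          rw [← List.nodup_reverse]
          simp [List.nodup_cons, t.2.1, FifoState.reverse]
        rw [← h1, ← h2, h]
      have hprod : (l.1.map q).prod * q r = (t.1.map q).prod * q j := by
        have := congrArg (fun m => (m.map q).prod) h
        simpa [mul_comm] using this
      simp [h, hn, hprod]
    · simp [h]
  · have hrev : t.reverse = l.reverse ↔ l = t := by
      rw [(FifoState.reverse_bijective C).1.eq_iff, eq_comm]
    by_cases h : l = t
    · subst h
      simp [FifoState.reverse]
    · simp [hrev, h]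

theorem map_reverse_apply {C : ℕ} (μ : PMF (FifoState C)) (l : FifoState C) :
    μ.map FifoState.reverse l = μ l.reverse := by
  have hrr : ∀ l : FifoState C, l.reverse.reverse = l := fun l =>
    Subtype.ext (List.reverse_reverse l.1)
  rw [PMF.map_apply, tsum_eq_single l.reverse, if_pos (hrr l).symm]
  intro b hb
  rw [if_neg]
  rintro rfl
  exact hb (hrr b).symm

theorem rnd_existsUnique_and_missProb (hq : ∀ r, q r ≠ 0) (C : ℕ) :
    (∃! μ : PMF (RndState C), IsStationary (rndStep q) μ) ∧
      ∀ μ : PMF (RndState C), IsStationary (rndStep q) μ → rndMissProb q μ =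
        (((C + 1 : ℕ) : ℝ≥0∞) * infEsymm q (C + 1) / infEsymm q C).toReal := by
  have hsum : ∑' i, q i ≠ ∞ := q.tsum_coe_ne_top
  have h0 : ∑' s : RndState C, ∏ i ∈ s.1, q i ≠ 0 := infEsymm_ne_zero hq C
  have h1 : ∑' s : RndState C, ∏ i ∈ s.1, q i ≠ ∞ := infEsymm_ne_top hsum C
  have hst := isStationary_normalize_of_balance (P := rndStep q) (Q := rndStep q) h0 h1 rnd_balance
  have huniq : ∀ μ : PMF (RndState C), IsStationary (rndStep q) μ → μ = PMF.normalize _ h0 h1 :=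
    fun μ hμ => hμ.eq_of_common_reachable
      (fun s t => ⟨t, rnd_reachable hq s t, Relation.ReflTransGen.refl⟩) hst
  refine ⟨⟨_, hst, huniq⟩, fun μ hμ => ?_⟩
  rw [huniq μ hμ, rndMissProb, missProb_normalize, succ_mul_infEsymm_succ]
  congr 2
  refine tsum_congr fun r => ?_
  rw [← tsum_ite_notMem_eq_infEsymm]
  congr 1
  refine tsum_congr fun s => ?_
  by_cases h : r ∈ s.1 <;> simp [h]

theorem fifo_existsUnique_and_missProb (hq : ∀ r, q r ≠ 0) (C : ℕ) :
    (∃! μ : PMF (FifoState C), IsStationary (fifoStep q) μ) ∧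
      ∀ μ : PMF (FifoState C), IsStationary (fifoStep q) μ → fifoMissProb q μ =
        (((C + 1 : ℕ) : ℝ≥0∞) * infEsymm q (C + 1) / infEsymm q C).toReal := by
  have hsum : ∑' i, q i ≠ ∞ := q.tsum_coe_ne_top
  have hC0 : (C.factorial : ℝ≥0∞) ≠ 0 := by exact_mod_cast C.factorial_ne_zero
  have hCtop : (C.factorial : ℝ≥0∞) ≠ ∞ := ENNReal.natCast_ne_top _
  have hw : ∑' l : FifoState C, (l.1.map q).prod = C.factorial * infEsymm q C :=
    listEsymm_eq_factorial_mul C q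
  have h0 : ∑' l : FifoState C, (l.1.map q).prod ≠ 0 := by
    rw [hw]
    exact mul_ne_zero hC0 (infEsymm_ne_zero hq C)
  have h1 : ∑' l : FifoState C, (l.1.map q).prod ≠ ∞ := by
    rw [hw]
    exact ENNReal.mul_ne_top hCtop (infEsymm_ne_top hsum C)
  have hst := isStationary_normalize_of_balance (P := fifoStep q)
    (Q := fun t => (fifoStep q t.reverse).map FifoState.reverse) h0 h1 fun l t => by
      rw [map_reverse_apply, fifo_balance]
  have huniq : ∀ μ : PMF (FifoState C), IsStationary (fifoStep q) μ → μ = PMF.normalize _ h0 h1 :=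
    fun μ hμ => hμ.eq_of_common_reachable (fifo_common_reachable hq) hst
  refine ⟨⟨_, hst, huniq⟩, fun μ hμ => ?_⟩
  rw [huniq μ hμ, fifoMissProb, missProb_normalize, hw,
    ← ENNReal.mul_div_mul_left _ (infEsymm q C) hC0 hCtop, succ_mul_infEsymm_succ, ← ENNReal.tsum_mul_left]
  congr 2
  refine tsum_congr fun r => ?_
  rw [mul_left_comm, ← listEsymm_eq_factorial_mul, ← tsum_ite_notMem_eq_listEsymm]
  congr 1
  refine tsum_congr fun l => ?_
  by_cases h : r ∈ l.1 <;> simp [h]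

end Cache

/-! ### Two-sided bounds on the ratio of consecutive symmetric functions. -/

section Interlacing

variable {ι : Type*} {q : ι → ℝ≥0∞}

/-- The ratio of consecutive elementary symmetric functions. -/
noncomputable def esymmRatio (q : ι → ℝ≥0∞) (k : ℕ) : ℝ :=
  (infEsymm q (k + 1)).toReal / (infEsymm q k).toReal

theorem summable_div_add (hq : ∑' i, q i ≠ ∞) {a : ℝ} (ha : 0 < a) :
    Summable fun r => (q r).toReal / (a + (q r).toReal) := by
  refine Summable.of_nonneg_of_le (fun r => by positivity) (fun r => ?_)
    ((ENNReal.summable_toReal hq).mul_left a⁻¹)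
  rw [inv_mul_eq_div]
  gcongr
  linarith [(q r).toReal_nonneg]

variable [DecidableEq ι]

theorem hasSum_toReal_mul_infEsymm (hq : ∑' i, q i ≠ ∞) (k : ℕ) :
    HasSum (fun r => (q r).toReal * (infEsymm (Function.update q r 0) k).toReal)
      ((k + 1) * (infEsymm q (k + 1)).toReal) := by
  have h := succ_mul_infEsymm_succ q k
  have htop : ∑' r, q r * infEsymm (Function.update q r 0) k ≠ ∞ := by
    rw [← h]
    exact ENNReal.mul_ne_top (ENNReal.natCast_ne_top _) (infEsymm_ne_top hq _)
  have := ENNReal.hasSum_toReal htop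
  simp_rw [ENNReal.toReal_mul] at this
  have h2 := congrArg ENNReal.toReal h
  rw [ENNReal.toReal_mul, ENNReal.toReal_natCast, ENNReal.tsum_toReal_eq] at h2
  · simp_rw [ENNReal.toReal_mul] at h2
    rw [← h2] at this
    exact_mod_cast this
  · exact fun r => ENNReal.ne_top_of_tsum_ne_top htop r

variable [Infinite ι]

theorem infEsymm_toReal_pos (h0 : ∀ i, q i ≠ 0) (hq : ∑' i, q i ≠ ∞) (k : ℕ) :
    0 < (infEsymm q k).toReal :=
  ENNReal.toReal_pos (infEsymm_ne_zero h0 k) (infEsymm_ne_top hq k)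

theorem esymmRatio_pos (h0 : ∀ i, q i ≠ 0) (hq : ∑' i, q i ≠ ∞) (k : ℕ) : 0 < esymmRatio q k :=
  div_pos (infEsymm_toReal_pos h0 hq _) (infEsymm_toReal_pos h0 hq _)

theorem tsum_div_esymmRatio_add_le (h0 : ∀ i, q i ≠ 0) (hq : ∑' i, q i ≠ ∞) (k : ℕ) :
    ∑' r, (q r).toReal / (esymmRatio q k + (q r).toReal) ≤ k + 1 := by
  have hE := infEsymm_toReal_pos h0 hq
  have ha := esymmRatio_pos h0 hq k
  have hs := (hasSum_toReal_mul_infEsymm hq k).div_const (infEsymm q (k + 1)).toReal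
  rw [mul_div_cancel_right₀ _ (hE (k + 1)).ne'] at hs
  rw [← hs.tsum_eq]
  refine (summable_div_add hq ha).tsum_le_tsum (fun r => ?_) hs.summable
  have htop : ∀ j, infEsymm (Function.update q r 0) j ≠ ∞ :=
    infEsymm_ne_top (tsum_update_zero_ne_top hq r)
  have hqr : q r ≠ ∞ := ENNReal.ne_top_of_tsum_ne_top hq r
  have h := ENNReal.toReal_mono (ENNReal.mul_ne_top (htop k) (ENNReal.add_ne_top.2
    ⟨infEsymm_ne_top hq _, ENNReal.mul_ne_top hqr (infEsymm_ne_top hq _)⟩))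
    (le_infEsymm_update_mul_add hq r k)
  rw [ENNReal.toReal_mul, ENNReal.toReal_mul, ENNReal.toReal_add (infEsymm_ne_top hq _)
    (ENNReal.mul_ne_top hqr (infEsymm_ne_top hq _)), ENNReal.toReal_mul] at h
  have hx : 0 ≤ (q r).toReal := ENNReal.toReal_nonneg
  have hr : esymmRatio q k * (infEsymm q k).toReal = (infEsymm q (k + 1)).toReal :=
    div_mul_cancel₀ _ (hE k).ne'
  -- Dividing by `e_k` gives `E_k ≥ e_{k+1} / (a_k + q_r)`, to be weighted by `q_r` and summed.
  have h' : (infEsymm q (k + 1)).toReal ≤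
      (infEsymm (Function.update q r 0) k).toReal * (esymmRatio q k + (q r).toReal) := by
    refine le_of_mul_le_mul_right ?_ (hE k)
    calc _ ≤ _ := h
      _ = _ := by rw [← hr]; ring
  rw [div_le_div_iff₀ (by positivity) (hE (k + 1)), mul_assoc]
  gcongr

theorem le_tsum_div_esymmRatio_add (h0 : ∀ i, q i ≠ 0) (hq : ∑' i, q i ≠ ∞) (k : ℕ) :
    k + 1 ≤ ∑' r, (q r).toReal / (esymmRatio q (k + 1) + (q r).toReal) := by
  have hE := infEsymm_toReal_pos h0 hq
  have ha := esymmRatio_pos h0 hq (k + 1)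
  have hs := (hasSum_toReal_mul_infEsymm hq k).div_const (infEsymm q (k + 1)).toReal
  rw [mul_div_cancel_right₀ _ (hE (k + 1)).ne'] at hs
  rw [← hs.tsum_eq]
  refine hs.summable.tsum_le_tsum (fun r => ?_) (summable_div_add hq ha)
  have hqr : q r ≠ ∞ := ENNReal.ne_top_of_tsum_ne_top hq r
  have h := ENNReal.toReal_mono (ENNReal.mul_ne_top (infEsymm_ne_top hq _)
    (infEsymm_ne_top hq _)) (infEsymm_update_mul_add_le hq r k)
  rw [ENNReal.toReal_mul, ENNReal.toReal_mul, ENNReal.toReal_add (infEsymm_ne_top hq _)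
    (ENNReal.mul_ne_top hqr (infEsymm_ne_top hq _)), ENNReal.toReal_mul] at h
  have hx : 0 ≤ (q r).toReal := ENNReal.toReal_nonneg
  have hr : esymmRatio q (k + 1) * (infEsymm q (k + 1)).toReal = (infEsymm q (k + 2)).toReal :=
    div_mul_cancel₀ _ (hE (k + 1)).ne'
  have h' : (infEsymm (Function.update q r 0) k).toReal * (esymmRatio q (k + 1) + (q r).toReal) ≤
      (infEsymm q (k + 1)).toReal := by
    refine le_of_mul_le_mul_right ?_ (hE (k + 1))
    calc _ = _ := by rw [← hr]; ring
      _ ≤ _ := h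
  rw [div_le_div_iff₀ (hE (k + 1)) (by positivity), mul_assoc]
  gcongr

end Interlacing

/-! ### The integral of `1 / (1 + u ^ p)` and the comparison of sum and integral. -/

section Integral

open MeasureTheory Set

/-- Writing `1 / (1 + u ^ p)` as the integral of `exp (-t (1 + u ^ p))` over `t` and swapping by
Tonelli gives `Γ(1 + 1/p) Γ(1 - 1/p)`; Euler's reflection formula concludes. -/
theorem lintegral_one_div_one_add_rpow {p : ℝ} (hp : 1 < p) :
    ∫⁻ u in Ioi (0 : ℝ), ENNReal.ofReal (1 / (1 + u ^ p)) =
      ENNReal.ofReal ((Real.pi / p) / Real.sin (Real.pi / p)) := by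
  have hp0 : 0 < p := by linarith
  have hinner : ∀ u ∈ Ioi (0 : ℝ), ENNReal.ofReal (1 / (1 + u ^ p)) =
      ∫⁻ t in Ioi (0 : ℝ), ENNReal.ofReal (Real.exp (-t) * Real.exp (-t * u ^ p)) := by
    intro u hu
    have hu0 : 0 < 1 + u ^ p := by
      have := Real.rpow_nonneg (le_of_lt hu) p
      linarith
    have h1 := integral_exp_neg_mul_rpow one_pos hu0
    have h2 := integrableOn_rpow_mul_exp_neg_mul_rpow (s := 0) (by norm_num) one_pos hu0
    simp only [Real.rpow_one, Real.rpow_zero, one_mul] at h1 h2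
    rw [show (-1 / 1 : ℝ) = -1 by norm_num, Real.rpow_neg_one, show (1 / 1 + 1 : ℝ) = 2 by norm_num,
      Real.Gamma_two, mul_one] at h1
    rw [one_div, ← h1, ofReal_integral_eq_lintegral_ofReal h2
      (Eventually.of_forall fun t => (Real.exp_pos _).le)]
    refine lintegral_congr fun t => ?_
    rw [← Real.exp_add]
    congr 2
    ring
  rw [setLIntegral_congr_fun measurableSet_Ioi hinner, lintegral_lintegral_swap
    (by fun_prop)]
  have houter : ∀ t ∈ Ioi (0 : ℝ),
      ∫⁻ u in Ioi (0 : ℝ), ENNReal.ofReal (Real.exp (-t) * Real.exp (-t * u ^ p)) =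
        ENNReal.ofReal (Real.Gamma (1 / p + 1)) *
          ENNReal.ofReal (Real.exp (-t) * t ^ ((1 - 1 / p) - 1)) := by
    intro t ht
    have ht0 : 0 < t := ht
    have h2 := integrableOn_rpow_mul_exp_neg_mul_rpow (s := 0) (by norm_num) hp0 ht0
    simp only [Real.rpow_zero, one_mul] at h2
    rw [← ofReal_integral_eq_lintegral_ofReal (h2.const_mul _)
      (Eventually.of_forall fun u => by positivity), integral_const_mul,
      integral_exp_neg_mul_rpow hp0 ht0,
      ← ENNReal.ofReal_mul (Real.Gamma_pos_of_pos (by positivity)).le]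
    congr 1
    rw [show (1 - 1 / p - 1 : ℝ) = -1 / p by ring]
    ring
  have hs : 0 < 1 - 1 / p := by
    have := (div_lt_one hp0).2 hp
    linarith
  rw [setLIntegral_congr_fun measurableSet_Ioi houter, lintegral_const_mul' _ _ ENNReal.ofReal_ne_top,
    ← ofReal_integral_eq_lintegral_ofReal (Real.GammaIntegral_convergent hs)
      ((ae_restrict_mem measurableSet_Ioi).mono fun t ht => ?_),
    ← Real.Gamma_eq_integral hs, ← ENNReal.ofReal_mul (Real.Gamma_pos_of_pos (by positivity)).le,
    Real.Gamma_add_one (by positivity), mul_assoc, Real.Gamma_mul_Gamma_one_sub]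
  · congr 1
    rw [mul_one_div]
    ring
  · have ht0 : 0 < t := ht
    positivity

theorem one_div_one_add_rpow_integral {p : ℝ} (hp : 1 < p) :
    IntegrableOn (fun u : ℝ => 1 / (1 + u ^ p)) (Ioi 0) ∧
      ∫ u in Ioi (0 : ℝ), 1 / (1 + u ^ p) = (Real.pi / p) / Real.sin (Real.pi / p) := by
  have hx : 0 < Real.pi / p := by positivity
  have hx' : Real.pi / p < Real.pi := div_lt_self Real.pi_pos hp
  have hs : 0 < Real.sin (Real.pi / p) := Real.sin_pos_of_pos_of_lt_pi hx hx'
  have hmeas : AEStronglyMeasurable (fun u : ℝ => 1 / (1 + u ^ p)) (volume.restrict (Ioi 0)) := by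
    have : Measurable (fun u : ℝ => 1 / (1 + u ^ p)) := by fun_prop
    exact this.aestronglyMeasurable
  have hnn : 0 ≤ᵐ[volume.restrict (Ioi 0)] fun u : ℝ => 1 / (1 + u ^ p) :=
    (ae_restrict_mem measurableSet_Ioi).mono fun t ht => by
      have ht0 : 0 < t := ht
      change 0 ≤ 1 / (1 + t ^ p)
      positivity
  refine ⟨⟨hmeas, ?_⟩, ?_⟩
  · rw [hasFiniteIntegral_iff_ofReal hnn, lintegral_one_div_one_add_rpow hp]
    exact ENNReal.ofReal_lt_top
  · rw [integral_eq_lintegral_of_nonneg_ae hnn hmeas, lintegral_one_div_one_add_rpow hp,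
      ENNReal.toReal_ofReal (by positivity)]

theorem tsum_one_div_one_add_rpow_bounds {p b : ℝ} (hp : 1 < p) (hb : 0 < b) :
    ∑' r : ℕ+, 1 / (1 + ((r : ℕ) / b) ^ p) ≤ b * ((Real.pi / p) / Real.sin (Real.pi / p)) ∧
      b * ((Real.pi / p) / Real.sin (Real.pi / p)) ≤
        1 + ∑' r : ℕ+, 1 / (1 + (((r : ℕ) : ℝ) / b) ^ p) := by
  obtain ⟨hint, hval⟩ := one_div_one_add_rpow_integral hp
  have hp0 : 0 < p := by linarith
  set f : ℝ → ℝ := fun x => 1 / (1 + (x / b) ^ p) with hf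
  have hbi : 0 < b⁻¹ := inv_pos.2 hb
  have hfint : IntegrableOn f (Ioi 0) := by
    have := (integrableOn_Ioi_comp_mul_left_iff (fun u : ℝ => 1 / (1 + u ^ p)) 0 hbi).2
      (by rwa [mul_zero])
    simpa only [hf, div_eq_inv_mul] using this
  have hfval : ∫ x in Ioi (0 : ℝ), f x = b * ((Real.pi / p) / Real.sin (Real.pi / p)) := by
    have := integral_comp_mul_left_Ioi (fun u : ℝ => 1 / (1 + u ^ p)) 0 hbi
    rw [mul_zero, hval, inv_inv, smul_eq_mul] at this
    rw [← this]
    simp only [hf, div_eq_inv_mul]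
  have hanti : AntitoneOn f (Ici 0) := by
    intro x hx y hy hxy
    have hx0 : (0 : ℝ) ≤ x := hx
    simp only [hf]
    gcongr
  have hnn : ∀ t ∈ Ioi (0 : ℝ), 0 ≤ f t := fun t ht => by
    have ht0 : (0 : ℝ) < t := ht
    simp only [hf]
    positivity
  have hsum := hanti.summable_of_integrableOn_Ioi_zero hfint hnn
  have hpnat : ∑' r : ℕ+, 1 / (1 + (((r : ℕ) : ℝ) / b) ^ p) = ∑' n : ℕ, f (n + 1 : ℕ) :=
    tsum_pnat_eq_tsum_succ (f := fun n : ℕ => f n)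
  rw [hpnat, ← hfval]
  refine ⟨hanti.tsum_add_one_le_integral hfint hnn, ?_⟩
  have h := hanti.integral_le_tsum hsum hnn
  -- The split-off term is `f 0 = 1`, the additive error in the second bound.
  rw [hsum.tsum_eq_zero_add] at h
  simpa [hf, Real.zero_rpow hp0.ne'] using h

end Integral

/-! ### Limits of the prefactor at infinity and at one. -/

section Rho

theorem rho_eq_inv_sinc {α : ℝ} (hα : 1 < α) :
    rho α = (Real.sinc (Real.pi / α) ^ α)⁻¹ := by
  have hx : 0 < Real.pi / α := by positivity
  have hx' : Real.pi / α < Real.pi := div_lt_self Real.pi_pos hα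
  have hs : 0 < Real.sin (Real.pi / α) := Real.sin_pos_of_pos_of_lt_pi hx hx'
  rw [rho, Real.sinc_of_ne_zero hx.ne', ← Real.inv_rpow (by positivity), inv_div]

theorem rho_pos {α : ℝ} (hα : 1 < α) : 0 < rho α := by
  have hx : 0 < Real.pi / α := by positivity
  have hx' : Real.pi / α < Real.pi := div_lt_self Real.pi_pos hα
  have hs : 0 < Real.sin (Real.pi / α) := Real.sin_pos_of_pos_of_lt_pi hx hx'
  rw [rho]
  positivity

theorem tendsto_rho_atTop : Tendsto rho atTop (𝓝 1) := by
  have h : Tendsto (fun α : ℝ => Real.sinc (Real.pi / α) ^ α) atTop (𝓝 1) := by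
    have hlow : Tendsto (fun α : ℝ => 1 - Real.pi ^ 2 / 6 * α⁻¹) atTop (𝓝 1) := by
      have := (tendsto_inv_atTop_zero (𝕜 := ℝ)).const_mul (Real.pi ^ 2 / 6)
      rw [mul_zero] at this
      simpa using this.const_sub 1
    refine tendsto_of_tendsto_of_tendsto_of_le_of_le' hlow tendsto_const_nhds ?_ ?_
    · filter_upwards [eventually_ge_atTop 4] with α hα
      have hα0 : 0 < α := by linarith
      have hx : 0 < Real.pi / α := by positivity
      have hx1 : Real.pi / α ≤ 1 := by
        rw [div_le_one hα0]
        linarith [Real.pi_le_four]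
      have hb : 1 - (Real.pi / α) ^ 2 / 6 ≤ Real.sinc (Real.pi / α) := by
        rw [Real.sinc_of_ne_zero hx.ne', le_div_iff₀ hx]
        have := Real.sin_gt_sub_cube hx
        linarith
      have hsq : (Real.pi / α) ^ 2 ≤ 1 := pow_le_one₀ hx.le hx1
      -- With `x = π / α`, Bernoulli turns `sinc x ≥ 1 - x ^ 2 / 6` into an error `α x ^ 2 / 6 = O(1
      -- / α)`.
      have hbern := one_add_mul_self_le_rpow_one_add (s := -((Real.pi / α) ^ 2 / 6))
        (by linarith) (p := α) (by linarith)
      calc 1 - Real.pi ^ 2 / 6 * α⁻¹ = 1 + α * -((Real.pi / α) ^ 2 / 6) := by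
            field_simp
            ring
        _ ≤ _ := hbern
        _ ≤ _ := by
          refine Real.rpow_le_rpow (by linarith) ?_ hα0.le
          linarith
    · filter_upwards [eventually_gt_atTop 1] with α hα
      have hx : 0 < Real.pi / α := by positivity
      have hx' : Real.pi / α < Real.pi := div_lt_self Real.pi_pos hα
      have hs : 0 < Real.sin (Real.pi / α) := Real.sin_pos_of_pos_of_lt_pi hx hx'
      refine Real.rpow_le_one ?_ (Real.sinc_le_one _) (by linarith)
      rw [Real.sinc_of_ne_zero hx.ne']
      positivity
  have h' := h.inv₀ one_ne_zero
  rw [inv_one] at h'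
  refine h'.congr' ?_
  filter_upwards [eventually_gt_atTop 1] with α hα
  rw [rho_eq_inv_sinc hα]

/-- Reflecting the sine about `π / 2` isolates the pole: the base of `rho α` is `(α - 1)⁻¹` over a
`sinc` tending to `1`. The exponential is `(α - 1) ^ (1 - α)`, in a form where continuity of `x log
x` at `0` applies. -/
theorem rho_mul_sub_one_eq {α : ℝ} (hα : 1 < α) :
    rho α * (α - 1) = Real.exp (-(Real.log (α - 1) * (α - 1))) *
      (Real.sinc (Real.pi * (α - 1) / α) ^ α)⁻¹ := by
  have hδ : 0 < α - 1 := by linarith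
  have hα0 : 0 < α := by linarith
  have hy : 0 < Real.pi * (α - 1) / α := by positivity
  have hsin : Real.sin (Real.pi / α) = Real.sin (Real.pi * (α - 1) / α) := by
    rw [← Real.sin_pi_sub]
    congr 1
    field_simp
  have hy' : Real.pi * (α - 1) / α < Real.pi := by
    rw [div_lt_iff₀ hα0]
    nlinarith [Real.pi_pos]
  have hs : 0 < Real.sin (Real.pi * (α - 1) / α) := Real.sin_pos_of_pos_of_lt_pi hy hy'
  have hbase : Real.pi / α / Real.sin (Real.pi / α) =
      (α - 1)⁻¹ * (Real.sinc (Real.pi * (α - 1) / α))⁻¹ := by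
    rw [Real.sinc_of_ne_zero hy.ne', hsin]
    field_simp
  have hsinc : 0 ≤ (Real.sinc (Real.pi * (α - 1) / α))⁻¹ := by
    rw [Real.sinc_of_ne_zero hy.ne']
    positivity
  rw [rho, hbase, Real.mul_rpow (by positivity) hsinc, Real.inv_rpow hδ.le,
    Real.inv_rpow (inv_nonneg.1 hsinc), mul_right_comm]
  congr 1
  rw [Real.rpow_def_of_pos hδ, ← Real.exp_neg]
  nth_rewrite 2 [← Real.exp_log hδ]
  rw [← Real.exp_add]
  congr 1
  ring

theorem rho_isEquivalent_one : rho ~[𝓝[>] 1] (fun α : ℝ => 1 / (α - 1)) := by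
  have hne : ∀ᶠ α : ℝ in 𝓝[>] 1, 1 / (α - 1) ≠ 0 := by
    filter_upwards [self_mem_nhdsWithin] with α hα
    have : (1 : ℝ) < α := hα
    exact (one_div_pos.2 (by linarith)).ne'
  rw [isEquivalent_iff_tendsto_one hne]
  have h1 : Tendsto (fun α : ℝ => Real.exp (-(Real.log (α - 1) * (α - 1)))) (𝓝[>] 1) (𝓝 1) := by
    have hc : Continuous fun x : ℝ => Real.exp (-(Real.log x * x)) := by
      have := Real.continuous_mul_log
      simp_rw [mul_comm (Real.log _)]
      fun_prop
    have := (hc.comp (continuous_id.sub continuous_const)).tendsto (1 : ℝ)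
      (f := (fun x : ℝ => Real.exp (-(Real.log x * x))) ∘ fun α : ℝ => id α - 1)
    simp only [Function.comp_def, id, sub_self, mul_zero, neg_zero, Real.exp_zero] at this
    exact this.mono_left nhdsWithin_le_nhds
  have h2 : Tendsto (fun α : ℝ => (Real.sinc (Real.pi * (α - 1) / α) ^ α)⁻¹) (𝓝[>] 1) (𝓝 1) := by
    have hy : Tendsto (fun α : ℝ => Real.pi * (α - 1) / α) (𝓝[>] 1) (𝓝 0) := by
      have : ContinuousAt (fun α : ℝ => Real.pi * (α - 1) / α) 1 :=
        ContinuousAt.div (by fun_prop) continuousAt_id one_ne_zero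
      have := this.tendsto
      simp only [sub_self, mul_zero, zero_div] at this
      exact this.mono_left nhdsWithin_le_nhds
    have hs : Tendsto (fun α : ℝ => Real.sinc (Real.pi * (α - 1) / α)) (𝓝[>] 1) (𝓝 1) := by
      have := (Real.continuous_sinc.tendsto 0).comp hy
      rwa [Real.sinc_zero] at this
    have hid : Tendsto (fun α : ℝ => α) (𝓝[>] 1) (𝓝 1) := tendsto_id.mono_left nhdsWithin_le_nhds
    have := (hs.rpow hid (Or.inl one_ne_zero)).inv₀ (by simp)
    simpa using this
  have h := h1.mul h2
  rw [one_mul] at h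
  refine h.congr' ?_
  filter_upwards [self_mem_nhdsWithin] with α hα
  have hα' : (1 : ℝ) < α := hα
  rw [← rho_mul_sub_one_eq hα', Pi.div_apply, div_div_eq_mul_div, div_one]

end Rho

/-! ### Asymptotics for Zipf weights. -/

section Zipf

variable {α : ℝ}

theorem zipfWeight_pos (hα : 1 < α) {r : ℕ} (hr : 0 < r) : 0 < zipfWeight α r := by
  have := zipfConst_pos hα
  have : (0 : ℝ) < r := by exact_mod_cast hr
  rw [zipfWeight]
  positivity

theorem zipf_toReal (hα : 1 < α) (r : ℕ+) : (zipf α hα r).toReal = zipfWeight α r :=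
  ENNReal.toReal_ofReal (zipfWeight_pos hα r.pos).le

theorem zipf_ne_zero (hα : 1 < α) (r : ℕ+) : zipf α hα r ≠ 0 :=
  (ENNReal.ofReal_pos.2 (zipfWeight_pos hα r.pos)).ne'

theorem zipf_div_add_eq (hα : 1 < α) {b : ℝ} (hb : 0 < b) (r : ℕ+) :
    (zipf α hα r).toReal / (zipfConst α / b ^ α + (zipf α hα r).toReal) =
      1 / (1 + (((r : ℕ) : ℝ) / b) ^ α) := by
  have hA := zipfConst_pos hα
  have hr : (0 : ℝ) < (r : ℕ) := by exact_mod_cast r.pos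
  have h1 : 0 < ((r : ℕ) : ℝ) ^ α := by positivity
  have h2 : 0 < b ^ α := by positivity
  rw [zipf_toReal hα, zipfWeight, Real.div_rpow hr.le hb.le]
  field_simp
  ring

/-- The ratio of consecutive elementary symmetric functions of the Zipf weights, up to an error of
order one on the scale of the degree. -/
theorem exists_esymmRatio_zipf_eq (hα : 1 < α) (k : ℕ) :
    ∃ b : ℝ, 0 < b ∧ esymmRatio (zipf α hα) k = zipfConst α / b ^ α ∧
      k ≤ b * ((Real.pi / α) / Real.sin (Real.pi / α)) ∧
      b * ((Real.pi / α) / Real.sin (Real.pi / α)) ≤ k + 2 := by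
  have hA := zipfConst_pos hα
  have hq0 := zipf_ne_zero hα
  have hq := (zipf α hα).tsum_coe_ne_top
  have ha := esymmRatio_pos hq0 hq k
  have hb : 0 < (zipfConst α / esymmRatio (zipf α hα) k) ^ α⁻¹ := by positivity
  refine ⟨_, hb, ?_, ?_⟩
  · rw [Real.rpow_inv_rpow (by positivity) (by linarith), div_div_cancel₀ hA.ne']
  have hratio : esymmRatio (zipf α hα) k =
      zipfConst α / ((zipfConst α / esymmRatio (zipf α hα) k) ^ α⁻¹) ^ α := by
    rw [Real.rpow_inv_rpow (by positivity) (by linarith), div_div_cancel₀ hA.ne']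
  generalize (zipfConst α / esymmRatio (zipf α hα) k) ^ α⁻¹ = b at hb hratio ⊢
  have hbounds := tsum_one_div_one_add_rpow_bounds hα hb
  simp_rw [← zipf_div_add_eq hα hb, ← hratio] at hbounds
  constructor
  · obtain _ | k := k
    · rw [Nat.cast_zero]
      exact le_trans (tsum_nonneg fun r => by positivity) hbounds.1
    · push_cast
      exact (le_tsum_div_esymmRatio_add hq0 hq k).trans hbounds.1
  · linarith [hbounds.2, tsum_div_esymmRatio_add_le hq0 hq k]

theorem missRatio_zipf_isEquivalent (hα : 1 < α) :
    (fun C : ℕ => (((C + 1 : ℕ) : ℝ≥0∞) * infEsymm (zipf α hα) (C + 1) /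
      infEsymm (zipf α hα) C).toReal) ~[atTop] fun C : ℕ => rho α * C * zipfWeight α C := by
  have hA := zipfConst_pos hα
  have hα0 : 0 < α := by linarith
  have hx : 0 < Real.pi / α := by positivity
  have hsin : 0 < Real.sin (Real.pi / α) :=
    Real.sin_pos_of_pos_of_lt_pi hx (div_lt_self Real.pi_pos hα)
  choose b hb0 hb hlow hupp using exists_esymmRatio_zipf_eq hα
  set θ := (Real.pi / α) / Real.sin (Real.pi / α) with hθ
  have hθ0 : 0 < θ := by positivity
  have hne : ∀ᶠ C : ℕ in atTop, rho α * C * zipfWeight α C ≠ 0 := by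
    filter_upwards [eventually_gt_atTop 0] with C hC
    have h1 := zipfWeight_pos hα hC
    have h2 := rho_pos hα
    have h3 : (0 : ℝ) < C := by exact_mod_cast hC
    positivity
  rw [isEquivalent_iff_tendsto_one hne]
  have hinv : Tendsto (fun C : ℕ => (C : ℝ)⁻¹) atTop (𝓝 0) := tendsto_inv_atTop_nhds_zero_nat
  have h1 : Tendsto (fun C : ℕ => 1 + (C : ℝ)⁻¹) atTop (𝓝 1) := by
    simpa using hinv.const_add 1
  have h2 : Tendsto (fun C : ℕ => b C * θ / C) atTop (𝓝 1) := by
    refine tendsto_of_tendsto_of_tendsto_of_le_of_le' tendsto_const_nhds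
      (by simpa using (hinv.const_mul 2).const_add 1 : Tendsto (fun C : ℕ => 1 + 2 * (C : ℝ)⁻¹)
        atTop (𝓝 1)) ?_ ?_ <;>
    filter_upwards [eventually_gt_atTop 0] with C hC
    · have h3 : (0 : ℝ) < C := by exact_mod_cast hC
      rw [le_div_iff₀ h3, one_mul]
      exact hlow C
    · have h3 : (0 : ℝ) < C := by exact_mod_cast hC
      rw [div_le_iff₀ h3]
      field_simp
      exact hupp C
  -- The quotient of the two sides is exactly `(1 + 1 / C) (b θ / C) ^ (-α)`.
  have h3 := h1.mul ((h2.rpow_const (Or.inl one_ne_zero) (p := α)).inv₀ (by simp))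
  rw [Real.one_rpow, inv_one, one_mul] at h3
  refine h3.congr' ?_
  filter_upwards [eventually_gt_atTop 0] with C hC
  have hC0 : (0 : ℝ) < C := by exact_mod_cast hC
  have hval : (((C + 1 : ℕ) : ℝ≥0∞) * infEsymm (zipf α hα) (C + 1) /
      infEsymm (zipf α hα) C).toReal = (C + 1) * (zipfConst α / b C ^ α) := by
    rw [← hb, esymmRatio, ENNReal.toReal_div, ENNReal.toReal_mul, ENNReal.toReal_natCast,
      mul_div_assoc]
    push_cast
    rfl
  rw [Pi.div_apply, hval, zipfWeight, rho, ← hθ, Real.div_rpow (mul_pos (hb0 C) hθ0).le hC0.le,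
    Real.mul_rpow (hb0 C).le hθ0.le]
  have hbC : 0 < b C ^ α := Real.rpow_pos_of_pos (hb0 C) α
  have hθα : 0 < θ ^ α := by positivity
  have hCα : 0 < (C : ℝ) ^ α := by positivity
  field_simp

theorem rho_mul_zipfWeight_eq {C : ℕ} (hC : 1 ≤ C) :
    rho α * C * zipfWeight α C = zipfConst α * rho α * (C : ℝ) ^ (1 - α) := by
  have hC0 : (0 : ℝ) < C := by exact_mod_cast hC
  rw [Real.rpow_sub hC0, Real.rpow_one, zipfWeight]
  ring

end Zipf

end CacheModel

theorem proposition3p9 :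
    (∀ (α : ℝ) (hα : 1 < α),
      -- existence and uniqueness of the stationary law of each cache
      (∀ C : ℕ, ∃! μ : PMF (CacheModel.RndState C),
        CacheModel.IsStationary (CacheModel.rndStep (CacheModel.zipf α hα)) μ) ∧
      (∀ C : ℕ, ∃! μ : PMF (CacheModel.FifoState C),
        CacheModel.IsStationary (CacheModel.fifoStep (CacheModel.zipf α hα)) μ) ∧
      -- RND
      (∀ μ : (C : ℕ) → PMF (CacheModel.RndState C),
        (∀ C, CacheModel.IsStationary (CacheModel.rndStep (CacheModel.zipf α hα)) (μ C)) →
        (fun C : ℕ => CacheModel.rndMissProb (CacheModel.zipf α hα) (μ C)) ~[atTop]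
          fun C : ℕ => CacheModel.rho α * C * CacheModel.zipfWeight α C) ∧
      -- FIFO
      (∀ μ : (C : ℕ) → PMF (CacheModel.FifoState C),
        (∀ C, CacheModel.IsStationary (CacheModel.fifoStep (CacheModel.zipf α hα)) (μ C)) →
        (fun C : ℕ => CacheModel.fifoMissProb (CacheModel.zipf α hα) (μ C)) ~[atTop]
          fun C : ℕ => CacheModel.rho α * C * CacheModel.zipfWeight α C) ∧
      (∀ C : ℕ, 1 ≤ C →
        CacheModel.rho α * C * CacheModel.zipfWeight α C =
          CacheModel.zipfConst α * CacheModel.rho α * (C : ℝ) ^ (1 - α))) ∧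
    Tendsto CacheModel.rho atTop (𝓝 1) ∧
    CacheModel.rho ~[𝓝[>] 1] (fun α : ℝ => 1 / (α - 1)) := by
  refine ⟨fun α hα => ?_, CacheModel.tendsto_rho_atTop, CacheModel.rho_isEquivalent_one⟩
  have hrnd := CacheModel.rnd_existsUnique_and_missProb (CacheModel.zipf_ne_zero hα)
  have hfifo := CacheModel.fifo_existsUnique_and_missProb (CacheModel.zipf_ne_zero hα)
  refine ⟨fun C => (hrnd C).1, fun C => (hfifo C).1, fun μ hμ => ?_, fun μ hμ => ?_,
    fun C hC => CacheModel.rho_mul_zipfWeight_eq hC⟩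
  · rw [funext fun C => (hrnd C).2 (μ C) (hμ C)]
    exact CacheModel.missRatio_zipf_isEquivalent hα
  · rw [funext fun C => (hfifo C).2 (μ C) (hμ C)]
    exact CacheModel.missRatio_zipf_isEquivalent hα
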